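/- Let $G$ be a finitely generated group and $H$ a finitely generated subgroup. For a subgroup $K\le G$, a subset $W\subseteq G$ is \emph{$K$-finite} if it lies in a finite union of cosets $Kg$; two subsets are \emph{$K$-almost equal} if their symmetric difference is $K$-finite. A subset $U\subseteq G$, with complement $U^*=G-U$, is \emph{$K$-almost invariant} if $kU=U$ for all $k\in K$ and the subset $K\backslash U$ of $K\backslash G$ has finite symmetric difference with its right translate $(K\backslash U)a$ for every $a\in G$; it is \emph{nontrivial} if $K\backslash U$ and $K\backslash U^*$ are both infinite. If $U$ is $K$-almost invariant and $W$ is $L$-almost invariant, then $U$ and $W$ are \emph{equivalent}, $U\sim W$, if they are $K$-almost equal. For $U$ nontrivial over $K$ and $W$ nontrivial over $L$, the set $U\cap W$ is \emph{small} if it is $K$-finite. (For nontrivial sets these two notions do not depend on the choice of $K$ and $L$.) The \emph{corners} of $(U,W)$ are $U\cap W$, $U\cap W^*$, $U^*\cap W$, $U^*\cap W^*$. Write $E(U)=\{gU,\,gU^*: g\in G\}$. The set $U$ is in \emph{good position} if, whenever two of the corners of a pair of elements of $E(U)$ are small, one of the corners of that pair is empty; it is \emph{invertible} if $gU=U^*$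 for some $g\in G$. For $A,B\in E(U)$ write $A\le B$ if $A\cap B^*$ is empty or is the only small one among the four corners of $(A,B)$. Let $X$ be a nontrivial $H$-almost invariant subset of $G$, let $\mathcal K$ be the subgroup $\{g\in G: gX\sim X\text{ or }gX\sim X^*\}$ of $G$, and let $Y$, $Z$, $V$ be almost invariant subsets of $G$ (over some subgroups), each equivalent to $X$, each in good position and each invertible. Then $\le$ is a partial order on each of $E(Y)$, $E(Z)$, $E(V)$, and one of the following holds: 1. between any two of $E(Y)$, $E(Z)$, $E(V)$ there is a $G$-equivariant bijection $\varphi$ which preserves complementation, the order ($A\le B$ if and only if $\varphi(A)\le\varphi(B)$) and equivalence classes ($\varphi(A)\sim A$ for all $A$); 2. $H$ has infinite index in $\mathcal K$, and there is such a bijection between at least two of $E(Y)$, $E(Z)$, $E(V)$. In particular, since in either case two of any three such posets are isomorphic in this sense, at most two partially ordered sets, up to such isomorphism, arise from invertible sets in good position that are equivalent to $X$. -/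

import Mathlib

open scoped Pointwise symmDiff

namespace AlmostInvariant

variable {G : Type*} [Group G]

/-- The right translate `X a` of a subset `X` of `G`. -/
def rightTranslate (X : Set G) (a : G) : Set G := (fun x => x * a) '' X

/-- The image `H \ X` of `X` in the set `H \ G` of cosets `H g`. -/
def cosetImage (H : Subgroup G) (X : Set G) : Set (Quotient (QuotientGroup.rightRel H)) :=
  (fun x => Quotient.mk (QuotientGroup.rightRel H) x) '' X

/-- `X` is `H`-almost invariant: it is invariant under the left action of `H`, and `H \ X` is an
almost invariant subset of `H \ G`, i.e. `(H \ X) a = H \ (X a)` and `H \ X` have finite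
symmetric difference for all `a` in `G`. -/
def IsAI (H : Subgroup G) (X : Set G) : Prop :=
  (∀ h ∈ H, h • X = X) ∧
    ∀ a : G, (cosetImage H (rightTranslate X a) ∆ cosetImage H X).Finite

/-- `X` is a nontrivial `H`-almost invariant set: `H \ X` and `H \ X*` are also infinite. -/
def IsNontrivialAI (H : Subgroup G) (X : Set G) : Prop :=
  IsAI H X ∧ (cosetImage H X).Infinite ∧ (cosetImage H Xᶜ).Infinite

/-- `W` is `H`-finite: it is contained in the union of finitely many cosets `H g`. -/
def HFinite (H : Subgroup G) (W : Set G) : Prop :=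
  ∃ F : Set G, F.Finite ∧ W ⊆ (H : Set G) * F

/-- `U` and `V` are `H`-almost equal. -/
def AlmostEq (H : Subgroup G) (U V : Set G) : Prop := HFinite H (U ∆ V)

/-- `X` and `Y` are equivalent: `X` is `H`-almost invariant and `Y` is `K`-almost invariant for
some subgroups `H` and `K`, and they are `H`-almost equal. For nontrivial `X` this does not
depend on the choice of `H` and `K`. -/
def Equivalent (X Y : Set G) : Prop :=
  ∃ H K : Subgroup G, IsAI H X ∧ IsAI K Y ∧ AlmostEq H X Y

/-- For nontrivial almost invariant sets `U` (over `H`) and `V` (over `K`): the intersection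
`U ∩ V` is small, i.e. `H`-finite. This does not depend on the choice of `H` and `K`. -/
def SmallInter (U V : Set G) : Prop :=
  ∃ H K : Subgroup G, IsNontrivialAI H U ∧ IsNontrivialAI K V ∧ HFinite H (U ∩ V)

/-- `X` or its complement. -/
def side (X : Set G) (b : Bool) : Set G := if b then X else Xᶜ

/-- The set `E(X)` of all translates of `X` and `X*`. -/
def E (X : Set G) : Set (Set G) := {A | ∃ g : G, A = g • X ∨ A = g • Xᶜ}

/-- `X` is in good position: if `U` and `V` are in `E(X)` and two of their four corners are
small, then one of their corners is empty. -/
def GoodPosition (X : Set G) : Prop :=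
  ∀ U ∈ E X, ∀ V ∈ E X,
    (∃ i j : Bool × Bool, i ≠ j ∧ SmallInter (side U i.1) (side V i.2) ∧
      SmallInter (side U j.1) (side V j.2)) →
    ∃ i : Bool × Bool, side U i.1 ∩ side V i.2 = ∅

/-- `U ≤ V`: the corner `U ∩ V*` is empty, or is the only small one among the four corners. -/
def AlmostLE (U V : Set G) : Prop :=
  U ∩ Vᶜ = ∅ ∨
    (SmallInter U Vᶜ ∧ ¬ SmallInter U V ∧ ¬ SmallInter Uᶜ V ∧ ¬ SmallInter Uᶜ Vᶜ)

/-- `X` is invertible: `g X = X*` for some `g` in `G`. -/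
def IsInvertible (X : Set G) : Prop := ∃ g : G, g • X = Xᶜ

theorem smul_mem_E {X A : Set G} (g : G) (hA : A ∈ E X) : g • A ∈ E X := by
  obtain ⟨k, rfl | rfl⟩ := hA
  · exact ⟨g * k, Or.inl (smul_smul _ _ _)⟩
  · exact ⟨g * k, Or.inr (smul_smul _ _ _)⟩

theorem compl_mem_E {X A : Set G} (hA : A ∈ E X) : Aᶜ ∈ E X := by
  obtain ⟨k, rfl | rfl⟩ := hA
  · exact ⟨k, Or.inr (Set.smul_set_compl).symm⟩
  · exact ⟨k, Or.inl (by rw [Set.smul_set_compl, compl_compl])⟩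

/-- The action of `G` on `E(X)` by left translation. -/
instance instMulActionE (X : Set G) : MulAction G (E X) where
  smul g A := ⟨g • (A : Set G), smul_mem_E g A.2⟩
  one_smul A := Subtype.ext (one_smul G (A : Set G))
  mul_smul g k A := Subtype.ext (mul_smul g k (A : Set G))

/-- The complementation of `E(X)`. -/
def starE {X : Set G} (A : E X) : E X := ⟨(A : Set G)ᶜ, compl_mem_E A.2⟩

/-- There is a `G`-equivariant bijection `E(Y) → E(Z)` which preserves complementation, the
ordering `≤` and equivalence classes. -/
def SamePoset (Y Z : Set G) : Prop :=
  ∃ φ : E Y ≃ E Z,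
    (∀ (g : G) (A : E Y), φ (g • A) = g • φ A) ∧
    (∀ A : E Y, φ (starE A) = starE (φ A)) ∧
    (∀ A B : E Y, AlmostLE (A : Set G) B ↔ AlmostLE (φ A : Set G) (φ B)) ∧
    ∀ A : E Y, Equivalent (A : Set G) (φ A)

/-! Facts needed to see that `𝒦(X)` is a subgroup. -/

theorem mem_cosets {H : Subgroup G} {F : Set G} {w : G} :
    w ∈ (H : Set G) * F ↔ ∃ f ∈ F, w * f⁻¹ ∈ H := by
  constructor
  · rintro ⟨h, hh, f, hf, rfl⟩
    exact ⟨f, hf, by simpa using hh⟩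
  · rintro ⟨f, hf, h⟩
    exact ⟨w * f⁻¹, h, f, hf, by simp⟩

theorem hFinite_iff {H : Subgroup G} {W : Set G} : HFinite H W ↔ (cosetImage H W).Finite := by
  constructor
  · rintro ⟨F, hF, hW⟩
    refine (hF.image (fun x => Quotient.mk (QuotientGroup.rightRel H) x)).subset ?_
    rintro _ ⟨w, hw, rfl⟩
    obtain ⟨f, hf, h⟩ := mem_cosets.1 (hW hw)
    exact ⟨f, hf, Quotient.sound (QuotientGroup.rightRel_apply.2 h)⟩
  · intro h
    refine ⟨Quotient.out '' cosetImage H W, h.image _, fun w hw => mem_cosets.2 ?_⟩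
    refine ⟨_, ⟨_, ⟨w, hw, rfl⟩, rfl⟩, ?_⟩
    exact QuotientGroup.rightRel_apply.1 (Quotient.mk_out (s := QuotientGroup.rightRel H) w)

theorem HFinite.mono {H : Subgroup G} {U W : Set G} (h : HFinite H W) (hU : U ⊆ W) :
    HFinite H U :=
  let ⟨F, hF, hW⟩ := h
  ⟨F, hF, hU.trans hW⟩

theorem HFinite.union {H : Subgroup G} {U W : Set G} (h : HFinite H U) (h' : HFinite H W) :
    HFinite H (U ∪ W) := by
  rw [hFinite_iff] at *
  rw [cosetImage, Set.image_union]
  exact h.union h'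

theorem HFinite.trans {H K : Subgroup G} {W : Set G} (h : HFinite H W) (h' : HFinite K (H : Set G)) :
    HFinite K W := by
  obtain ⟨F, hF, hW⟩ := h
  obtain ⟨F', hF', hH⟩ := h'
  refine ⟨F' * F, hF'.mul hF, hW.trans ?_⟩
  rw [← mul_assoc]
  exact Set.mul_subset_mul_right hH

theorem HFinite.right {H : Subgroup G} {W : Set G} (h : HFinite H W) (a : G) :
    HFinite H (rightTranslate W a) := by
  obtain ⟨F, hF, hW⟩ := h
  refine ⟨rightTranslate F a, hF.image _, ?_⟩
  rintro _ ⟨w, hw, rfl⟩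
  obtain ⟨f, hf, h⟩ := mem_cosets.1 (hW hw)
  exact mem_cosets.2 ⟨f * a, ⟨f, hf, rfl⟩, by simpa [mul_assoc] using h⟩

theorem mem_rightTranslate {X : Set G} {a x : G} : x ∈ rightTranslate X a ↔ x * a⁻¹ ∈ X := by
  constructor
  · rintro ⟨y, hy, rfl⟩
    simpa using hy
  · intro h
    exact ⟨_, h, by simp⟩

theorem inv_iff {H : Subgroup G} {X : Set G} (hX : ∀ h ∈ H, h • X = X) {h : G} (hh : h ∈ H)
    {x : G} : h * x ∈ X ↔ x ∈ X := by
  conv_lhs => rw [← hX h hh]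
  exact Set.smul_mem_smul_set_iff (a := h) (x := x)

theorem mk_mem_cosetImage {H : Subgroup G} {X : Set G} (hX : ∀ h ∈ H, h • X = X) {x : G} :
    Quotient.mk (QuotientGroup.rightRel H) x ∈ cosetImage H X ↔ x ∈ X := by
  constructor
  · rintro ⟨y, hy, h⟩
    have := QuotientGroup.rightRel_apply.1 (Quotient.exact h)
    rw [← inv_iff hX this] at hy
    simpa using hy
  · intro h
    exact ⟨x, h, rfl⟩

theorem inv_right {H : Subgroup G} {X : Set G} (hX : ∀ h ∈ H, h • X = X) (a : G) :
    ∀ h ∈ H, h • rightTranslate X a = rightTranslate X a := by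
  intro h hh
  ext x
  rw [Set.mem_smul_set_iff_inv_smul_mem, mem_rightTranslate, mem_rightTranslate, smul_eq_mul,
    mul_assoc, inv_iff hX (H.inv_mem hh)]

/-- `X` is `H`-almost invariant if and only if it is left `H`-invariant and `X a` is `H`-almost
equal to `X` for all `a` in `G`. -/
theorem isAI_iff {H : Subgroup G} {X : Set G} :
    IsAI H X ↔ (∀ h ∈ H, h • X = X) ∧ ∀ a : G, AlmostEq H (rightTranslate X a) X := by
  refine and_congr_right fun hX => forall_congr' fun a => ?_
  rw [AlmostEq, hFinite_iff]
  refine iff_of_eq (congrArg Set.Finite ?_)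
  ext q
  induction q using Quotient.inductionOn with | _ x => ?_
  have hs : ∀ h ∈ H, h • (rightTranslate X a ∆ X) = rightTranslate X a ∆ X := by
    intro h hh
    rw [Set.smul_set_symmDiff, inv_right hX a h hh, hX h hh]
  rw [mk_mem_cosetImage hs, Set.mem_symmDiff, Set.mem_symmDiff, mk_mem_cosetImage hX,
    mk_mem_cosetImage (inv_right hX a)]

theorem AlmostEq.trans {H : Subgroup G} {U V W : Set G} (h : AlmostEq H U V)
    (h' : AlmostEq H V W) : AlmostEq H U W :=
  (HFinite.union h h').mono (symmDiff_triangle U V W)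

theorem AlmostEq.symm {H : Subgroup G} {U V : Set G} (h : AlmostEq H U V) : AlmostEq H V U := by
  rwa [AlmostEq, symmDiff_comm]

theorem AlmostEq.compl {H : Subgroup G} {U V : Set G} (h : AlmostEq H U V) :
    AlmostEq H Uᶜ Vᶜ := by
  rwa [AlmostEq, compl_symmDiff_compl]

theorem AlmostEq.refl (H : Subgroup G) (U : Set G) : AlmostEq H U U :=
  ⟨∅, Set.finite_empty, by simp⟩

theorem rightTranslate_compl (X : Set G) (a : G) : rightTranslate Xᶜ a = (rightTranslate X a)ᶜ := by
  ext x
  simp [mem_rightTranslate]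

theorem rightTranslate_smul (X : Set G) (g a : G) :
    rightTranslate (g • X) a = g • rightTranslate X a := by
  ext x
  simp [mem_rightTranslate, Set.mem_smul_set_iff_inv_smul_mem, mul_assoc]

theorem IsAI.compl {H : Subgroup G} {X : Set G} (h : IsAI H X) : IsAI H Xᶜ := by
  rw [isAI_iff] at *
  refine ⟨fun k hk => by rw [Set.smul_set_compl, h.1 k hk], fun a => ?_⟩
  rw [rightTranslate_compl]
  exact (h.2 a).compl

theorem IsNontrivialAI.compl {H : Subgroup G} {X : Set G} (h : IsNontrivialAI H X) :
    IsNontrivialAI H Xᶜ :=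
  ⟨h.1.compl, h.2.2, by rw [compl_compl]; exact h.2.1⟩

/-- The conjugate subgroup `g H g⁻¹`. -/
def conjSubgroup (g : G) (H : Subgroup G) : Subgroup G := H.map (MulAut.conj g).toMonoidHom

theorem mem_conjSubgroup {g x : G} {H : Subgroup G} :
    x ∈ conjSubgroup g H ↔ g⁻¹ * x * g ∈ H := by
  constructor
  · rintro ⟨h, hh, rfl⟩
    simpa [mul_assoc] using hh
  · intro h
    exact ⟨_, h, by simp [mul_assoc]⟩

theorem hFinite_conj {g : G} {H : Subgroup G} {W : Set G} :
    HFinite (conjSubgroup g H) W ↔ HFinite H (g⁻¹ • W) := by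
  constructor
  · rintro ⟨F, hF, hW⟩
    refine ⟨g⁻¹ • F, hF.image _, ?_⟩
    rintro _ ⟨w, hw, rfl⟩
    obtain ⟨f, hf, h⟩ := mem_cosets.1 (hW hw)
    refine mem_cosets.2 ⟨g⁻¹ • f, Set.smul_mem_smul_set hf, ?_⟩
    simpa [mul_assoc] using mem_conjSubgroup.1 h
  · rintro ⟨F, hF, hW⟩
    refine ⟨g • F, hF.image _, fun w hw => ?_⟩
    obtain ⟨f, hf, h⟩ := mem_cosets.1 (hW (Set.smul_mem_smul_set hw))
    refine mem_cosets.2 ⟨g • f, Set.smul_mem_smul_set hf, mem_conjSubgroup.2 ?_⟩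
    simpa [mul_assoc] using h

theorem IsAI.conj {H : Subgroup G} {X : Set G} (h : IsAI H X) (g : G) :
    IsAI (conjSubgroup g H) (g • X) := by
  rw [isAI_iff] at *
  refine ⟨fun k hk => ?_, fun a => ?_⟩
  · have := h.1 _ (mem_conjSubgroup.1 hk)
    rw [← smul_eq_mul, ← smul_eq_mul, smul_assoc, smul_assoc, inv_smul_eq_iff] at this
    exact this
  · rw [AlmostEq, hFinite_conj, rightTranslate_smul, ← Set.smul_set_symmDiff, inv_smul_smul]
    exact h.2 a

theorem IsNontrivialAI.conj {H : Subgroup G} {X : Set G} (h : IsNontrivialAI H X) (g : G) :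
    IsNontrivialAI (conjSubgroup g H) (g • X) := by
  refine ⟨h.1.conj g, ?_, ?_⟩
  · rw [Set.Infinite, ← hFinite_iff, hFinite_conj, inv_smul_smul, hFinite_iff]
    exact h.2.1
  · rw [Set.Infinite, ← hFinite_iff, hFinite_conj, ← Set.smul_set_compl, inv_smul_smul,
      hFinite_iff]
    exact h.2.2

/-- Equivalent almost invariant sets, the first nontrivial, are over commensurable subgroups. -/
theorem comm_aux {H K : Subgroup G} {X Y : Set G} (hX : IsNontrivialAI H X) (hY : IsAI K Y)
    (h : AlmostEq H X Y) : HFinite K (H : Set G) ∧ HFinite H (K : Set G) := by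
  obtain ⟨⟨hX0, hi, hi'⟩, hY0⟩ := And.intro hX (isAI_iff.1 hY)
  have hX1 := isAI_iff.1 hX0
  have pick : ∀ A B : Set G, (∀ k ∈ H, k • A = A) → (cosetImage H A).Infinite →
      HFinite H (A ∆ B) → ∃ p, ∀ k ∈ H, k * p ∈ B := by
    intro A B hA hAi hAB
    obtain ⟨F, hF, hs⟩ := hAB
    have : ¬ A ⊆ (H : Set G) * F := fun hc => hAi (hFinite_iff.1 ⟨F, hF, hc⟩)
    obtain ⟨p, hp, hpF⟩ := Set.not_subset.1 this
    refine ⟨p, fun k hk => ?_⟩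
    by_contra hB
    apply hpF
    obtain ⟨f, hf, hm⟩ := mem_cosets.1
      (hs (Set.mem_symmDiff.2 (Or.inl ⟨(inv_iff hA hk).2 hp, hB⟩)))
    refine mem_cosets.2 ⟨f, hf, ?_⟩
    rw [mul_assoc] at hm
    exact (H.mul_mem_cancel_left hk).1 hm
  obtain ⟨p, hp⟩ := pick X Y hX1.1 hi h
  obtain ⟨q, hq⟩ := pick Xᶜ Yᶜ hX0.compl.1 hi' h.compl
  have back : ∀ {L M : Subgroup G}, HFinite L (rightTranslate (M : Set G) p) →
      HFinite L (M : Set G) := by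
    intro L M hL
    refine (hL.right p⁻¹).mono fun x hx => ?_
    rw [mem_rightTranslate, mem_rightTranslate]
    simpa using hx
  have key : ∀ k : G, k * p ∈ rightTranslate Y (q⁻¹ * p) ↔
      k * q ∈ Y := by
    intro k
    rw [mem_rightTranslate]
    simp [mul_assoc]
  have hmem : ∀ k ∈ H, k * p ∈ rightTranslate Y (q⁻¹ * p) ∆ Y := fun k hk =>
    Set.mem_symmDiff.2 (Or.inr ⟨hp k hk, fun hc => hq k hk ((key k).1 hc)⟩)
  refine ⟨back ((hY0.2 (q⁻¹ * p)).mono ?_), back (HFinite.mono (W :=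
    rightTranslate Y (q⁻¹ * p) ∆ Y) ?_ ?_)⟩
  · rintro _ ⟨k, hk, rfl⟩
    exact hmem k hk
  · have h1 : AlmostEq H (rightTranslate Y (q⁻¹ * p)) (rightTranslate X (q⁻¹ * p)) := by
      refine (HFinite.right h.symm (q⁻¹ * p)).mono fun x hx => ?_
      simpa only [Set.mem_symmDiff, mem_rightTranslate] using hx
    exact (h1.trans (hX1.2 _)).trans h
  · rintro _ ⟨k, hk, rfl⟩
    have hs : k • (rightTranslate Y (q⁻¹ * p) ∆ Y) = rightTranslate Y (q⁻¹ * p) ∆ Y := by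
      rw [Set.smul_set_symmDiff, inv_right hY0.1 _ k hk, hY0.1 k hk]
    have := hmem 1 H.one_mem
    rw [one_mul] at this
    rw [← hs]
    exact Set.smul_mem_smul_set this

theorem equivalent_smul_iff {H : Subgroup G} {X Y : Set G} (hX : IsNontrivialAI H X)
    (hY : IsNontrivialAI H Y) (g : G) :
    Equivalent (g • X) Y ↔
      (∀ W : Set G, HFinite H (g⁻¹ • W) ↔ HFinite H W) ∧ AlmostEq H (g • X) Y := by
  constructor
  · rintro ⟨H₁, K₁, h1, h2, h3⟩
    have a1 := comm_aux (hX.conj g) h1 (AlmostEq.refl _ _)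
    have h3' : AlmostEq (conjSubgroup g H) (g • X) Y := HFinite.trans h3 a1.2
    have a2 := comm_aux (hX.conj g) h2 h3'
    have a3 := comm_aux hY h2 (AlmostEq.refl _ _)
    have hW : ∀ W : Set G, HFinite H (g⁻¹ • W) ↔ HFinite H W := fun W => by
      rw [← hFinite_conj]
      exact ⟨fun hw => (hw.trans a2.1).trans a3.2, fun hw => (hw.trans a3.1).trans a2.2⟩
    exact ⟨hW, (hW _).1 (hFinite_conj.1 h3')⟩
  · rintro ⟨hW, h⟩
    exact ⟨conjSubgroup g H, H, hX.1.conj g, hY.1, hFinite_conj.2 ((hW _).2 h)⟩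

theorem AlmostEq.smul {H : Subgroup G} {g : G} {U V : Set G}
    (hg : ∀ W : Set G, HFinite H (g⁻¹ • W) ↔ HFinite H W) (h : AlmostEq H U V) :
    AlmostEq H (g • U) (g • V) := by
  rw [AlmostEq, ← hg, ← Set.smul_set_symmDiff, inv_smul_smul]
  exact h

/-- The subgroup `𝒦(X) = {g ∈ G : g X ∼ X or g X ∼ X*}` of `G`, for a nontrivial `H`-almost
invariant set `X`. -/
def stabK {H : Subgroup G} {X : Set G} (hX : IsNontrivialAI H X) : Subgroup G where
  carrier := {g | Equivalent (g • X) X ∨ Equivalent (g • X) Xᶜ}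
  one_mem' := by
    left
    rw [equivalent_smul_iff hX hX]
    simpa using AlmostEq.refl H X
  mul_mem' := by
    intro a b ha hb
    simp only [Set.mem_ofPred_eq, equivalent_smul_iff hX hX, equivalent_smul_iff hX hX.compl,
      ← and_or_left] at *
    obtain ⟨ha, ha'⟩ := ha
    obtain ⟨hb, hb'⟩ := hb
    refine ⟨fun W => ?_, ?_⟩
    · rw [mul_inv_rev, mul_smul, hb, ha]
    · rw [mul_smul]
      rcases hb' with hb' | hb'
      · exact ha'.imp (hb'.smul ha).trans (hb'.smul ha).trans
      · have := hb'.smul ha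
        rw [Set.smul_set_compl] at this
        refine ha'.symm.imp (fun h => this.trans ?_) (fun h => this.trans h.compl)
        simpa using h.compl
  inv_mem' := by
    intro a ha
    simp only [Set.mem_ofPred_eq, equivalent_smul_iff hX hX, equivalent_smul_iff hX hX.compl,
      ← and_or_left] at *
    obtain ⟨ha, ha'⟩ := ha
    have hi : ∀ W : Set G, HFinite H (a⁻¹⁻¹ • W) ↔ HFinite H W := fun W => by
      rw [inv_inv, ← ha, inv_smul_smul]
    refine ⟨hi, ha'.imp (fun h => ?_) (fun h => ?_)⟩
    · have := (h.smul hi).symm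
      rwa [inv_smul_smul] at this
    · have := (h.smul hi).symm.compl
      rwa [inv_smul_smul, Set.smul_set_compl, compl_compl] at this

end AlmostInvariant

open AlmostInvariant

/-!
A set `A` equivalent to `Z` and in good position has the same stabilizer `S` as `Z`, and counting
cosets of `S` with sign in the difference of two such sets gives an integer `height A B`, additive
in the sense that `height A C = height A B + height B C`. The translates of `Y` equivalent to `Y`
are nested, hence determined and ordered by their heights relative to `Y`, and these heights form a
subgroup `M` of `ℤ`. The order on `E(Y)` is encoded in the action of `G` on heights, which is the
same for `Y` and `Z`.

If `r Y = Y*` and `t Z = Z*`, then `A ↦ (r A)*` reflects heights and fixes `Y`; it takes `Z` to the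
translate `r t Z`, and so `2 * height Y Z` lies in `M`. When `height Y Z` itself lies in `M`, some
translate of `Y` has the height of `Z`, is inverted by `t` as well, and `E(Y)` and `E(Z)` are
isomorphic. Since the classes modulo `M` of order at most two form a group of order at most two, two
of `0`, `height Y Z` and `height Y V` agree modulo `M`. If `H` has finite index in `𝒦`, then `M` is
trivial and all three heights vanish.
-/

namespace AlmostInvariant

open MulAction (stabilizer)

variable {G : Type*} [Group G]

/-! ### Nontrivial sets and their equivalence -/

/-- `A` is a nontrivial almost invariant set over some subgroup. By
`IsNontrivial.isNontrivialAI_stabilizer` that subgroup may be taken to be the stabilizer of `A`. -/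
def IsNontrivial (A : Set G) : Prop := ∃ K : Subgroup G, IsNontrivialAI K A

section Equivalence

variable {H K : Subgroup G} {A B C W : Set G}

theorem IsNontrivial.compl (hA : IsNontrivial A) : IsNontrivial Aᶜ :=
  hA.imp fun _ => IsNontrivialAI.compl

theorem isNontrivial_compl_iff : IsNontrivial Aᶜ ↔ IsNontrivial A :=
  ⟨fun h => compl_compl A ▸ h.compl, IsNontrivial.compl⟩

theorem IsNontrivial.smul (hA : IsNontrivial A) (g : G) : IsNontrivial (g • A) :=
  let ⟨_, hK⟩ := hA
  ⟨_, hK.conj g⟩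

theorem IsNontrivial.of_mem_E (hA : IsNontrivial A) (hB : B ∈ E A) : IsNontrivial B := by
  obtain ⟨g, rfl | rfl⟩ := hB
  · exact hA.smul g
  · exact hA.compl.smul g

theorem IsNontrivialAI.not_hFinite (hA : IsNontrivialAI H A) : ¬ HFinite H A :=
  fun h => hA.2.1 (hFinite_iff.1 h)

theorem HFinite.of_le (h : HFinite H W) (hHK : H ≤ K) : HFinite K W :=
  let ⟨F, hF, hW⟩ := h
  ⟨F, hF, hW.trans (Set.mul_subset_mul_right hHK)⟩

theorem HFinite.of_almostEq (h : HFinite H A) (hAB : AlmostEq H A B) : HFinite H B :=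
  (h.union hAB).mono fun x hx => by
    by_cases hA : x ∈ A
    · exact Or.inl hA
    · exact Or.inr (Or.inr ⟨hx, hA⟩)

theorem hFinite_congr (hA : IsNontrivialAI H A) (hB : IsAI K B) (h : AlmostEq H A B) :
    HFinite H W ↔ HFinite K W :=
  ⟨fun hW => hW.trans (comm_aux hA hB h).1, fun hW => hW.trans (comm_aux hA hB h).2⟩

theorem IsNontrivialAI.of_almostEq (hA : IsNontrivialAI H A) (hB : IsAI K B)
    (h : AlmostEq H A B) : IsNontrivialAI K B := by
  refine ⟨hB, ?_, ?_⟩ <;> rw [Set.Infinite, ← hFinite_iff, ← hFinite_congr hA hB h]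
  · exact fun hc => hA.not_hFinite (hc.of_almostEq h.symm)
  · exact fun hc => hA.compl.not_hFinite (hc.of_almostEq h.compl.symm)

theorem IsNontrivial.isNontrivialAI_stabilizer (hA : IsNontrivial A) :
    IsNontrivialAI (stabilizer G A) A := by
  obtain ⟨K, hK⟩ := hA
  have hle : K ≤ stabilizer G A := fun k hk => hK.1.1 k hk
  have hS : IsAI (stabilizer G A) A :=
    isAI_iff.2 ⟨fun _ hs => hs, fun a => HFinite.of_le ((isAI_iff.1 hK.1).2 a) hle⟩
  exact hK.of_almostEq hS (AlmostEq.refl _ _)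

theorem IsNontrivial.hFinite_iff_stabilizer (hA : IsNontrivial A) (hK : IsAI K A) :
    HFinite K W ↔ HFinite (stabilizer G A) W :=
  (hFinite_congr hA.isNontrivialAI_stabilizer hK (AlmostEq.refl _ _)).symm

theorem Equivalent.almostEq_stabilizer (h : Equivalent A B) (hA : IsNontrivial A) :
    AlmostEq (stabilizer G A) A B :=
  let ⟨_, _, hHA, _, hAB⟩ := h
  (hA.hFinite_iff_stabilizer hHA).1 hAB

theorem IsNontrivial.of_equivalent (hA : IsNontrivial A) (h : Equivalent A B) :
    IsNontrivial B :=
  let ⟨_, K, _, hKB, _⟩ := h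
  ⟨K, hA.isNontrivialAI_stabilizer.of_almostEq hKB (h.almostEq_stabilizer hA)⟩

theorem equivalent_iff_almostEq (hA : IsNontrivial A) (hB : IsNontrivial B) :
    Equivalent A B ↔ AlmostEq (stabilizer G A) A B :=
  ⟨fun h => h.almostEq_stabilizer hA, fun h =>
    ⟨_, _, hA.isNontrivialAI_stabilizer.1, hB.isNontrivialAI_stabilizer.1, h⟩⟩

theorem Equivalent.hFinite_stabilizer_iff (h : Equivalent A B) (hA : IsNontrivial A) :
    HFinite (stabilizer G A) W ↔ HFinite (stabilizer G B) W :=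
  hFinite_congr hA.isNontrivialAI_stabilizer (hA.of_equivalent h).isNontrivialAI_stabilizer.1
    (h.almostEq_stabilizer hA)

theorem IsNontrivial.equivalent_refl (hA : IsNontrivial A) : Equivalent A A :=
  (equivalent_iff_almostEq hA hA).2 (AlmostEq.refl _ _)

theorem Equivalent.symm (h : Equivalent A B) (hA : IsNontrivial A) : Equivalent B A :=
  (equivalent_iff_almostEq (hA.of_equivalent h) hA).2
    ((h.hFinite_stabilizer_iff hA).1 (h.almostEq_stabilizer hA).symm)

theorem Equivalent.trans (h : Equivalent A B) (h' : Equivalent B C) (hA : IsNontrivial A) :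
    Equivalent A C := by
  have hB := hA.of_equivalent h
  refine (equivalent_iff_almostEq hA (hB.of_equivalent h')).2 ?_
  exact (h.almostEq_stabilizer hA).trans
    ((h.hFinite_stabilizer_iff hA).2 (h'.almostEq_stabilizer hB))

theorem Equivalent.smul (h : Equivalent A B) (g : G) : Equivalent (g • A) (g • B) := by
  obtain ⟨H, K, hA, hB, hAB⟩ := h
  refine ⟨_, _, hA.conj g, hB.conj g, ?_⟩
  rwa [AlmostEq, hFinite_conj, ← Set.smul_set_symmDiff, inv_smul_smul]

theorem Equivalent.smul_congr (h : Equivalent A B) (hA : IsNontrivial A) {g k : G}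
    (hgk : Equivalent (g • A) (k • A)) : Equivalent (g • B) (k • B) :=
  (((h.smul g).symm (hA.smul g)).trans hgk ((hA.of_equivalent h).smul g)).trans (h.smul k)
    ((hA.of_equivalent h).smul g)

theorem Equivalent.smul_self_congr (h : Equivalent A B) (hA : IsNontrivial A) {g : G}
    (hg : Equivalent (g • A) A) : Equivalent (g • B) B := by
  have := h.smul_congr hA (g := g) (k := 1)
  rw [one_smul, one_smul] at this
  exact this hg

theorem equivalent_smul_smul_iff {g k : G} :
    Equivalent (g • A) (k • B) ↔ Equivalent ((k⁻¹ * g) • A) B := by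
  constructor <;> intro h
  · simpa only [mul_smul, inv_smul_smul] using h.smul k⁻¹
  · simpa only [← mul_smul, mul_inv_cancel_left] using h.smul k

end Equivalence

/-! ### Almost inclusion and the order -/

section AlmostSubset

variable {A A' B B' C W P : Set G}

theorem smallInter_iff (hA : IsNontrivial A) (hB : IsNontrivial B) :
    SmallInter A B ↔ HFinite (stabilizer G A) (A ∩ B) :=
  ⟨fun ⟨_, _, hHA, _, hAB⟩ => (hA.hFinite_iff_stabilizer hHA.1).1 hAB, fun h =>
    ⟨_, _, hA.isNontrivialAI_stabilizer, hB.isNontrivialAI_stabilizer, h⟩⟩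

theorem SmallInter.isNontrivial_left (h : SmallInter A B) : IsNontrivial A :=
  let ⟨H, _, hA, _⟩ := h
  ⟨H, hA⟩

theorem SmallInter.isNontrivial_right (h : SmallInter A B) : IsNontrivial B :=
  let ⟨_, K, _, hB, _⟩ := h
  ⟨K, hB⟩

theorem SmallInter.not_compl (h : SmallInter A B) : ¬ SmallInter A Bᶜ := by
  have hA := h.isNontrivial_left
  have hB := h.isNontrivial_right
  rw [smallInter_iff hA hB] at h
  rw [smallInter_iff hA hB.compl]
  refine fun h' => hA.isNontrivialAI_stabilizer.not_hFinite ((h.union h').mono ?_)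
  rw [Set.inter_union_compl]

theorem exists_coset_disjoint {L : Subgroup G} (hPL : ∀ l ∈ L, l • P = P) (hP : ¬ HFinite L P)
    (hPA : HFinite L (P ∩ A)) : ∃ u : G, ∀ l ∈ L, l * u ∉ A := by
  obtain ⟨F, hF, hPAF⟩ := hPA
  obtain ⟨u, huP, huF⟩ := Set.not_subset.1 fun hPF => hP ⟨F, hF, hPF⟩
  refine ⟨u, fun l hl hlA => huF ?_⟩
  obtain ⟨f, hf, hlf⟩ := mem_cosets.1 (hPAF ⟨(inv_iff hPL hl).2 huP, hlA⟩)
  rw [mul_assoc] at hlf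
  exact mem_cosets.2 ⟨f, hf, (L.mul_mem_cancel_left hl).1 hlf⟩

/-- A coset `L f` meeting `A` is the right translate by `u⁻¹ f` of the coset `L u`, which misses
`A`; so it meets `A` inside the `K`-finite set `A (u⁻¹ f) ∆ A`. -/
theorem IsAI.hFinite_of_coset_disjoint {L K : Subgroup G} (hA : IsAI K A) (hWA : W ⊆ A)
    (hW : HFinite L W) {u : G} (hu : ∀ l ∈ L, l * u ∉ A) : HFinite K W := by
  obtain ⟨F, hF, hWF⟩ := hW
  have hK : HFinite K (⋃ f ∈ F, rightTranslate A (u⁻¹ * f) ∆ A) := by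
    rw [hFinite_iff, cosetImage, Set.image_iUnion₂]
    exact hF.biUnion fun f _ => hFinite_iff.1 ((isAI_iff.1 hA).2 _)
  refine hK.mono fun w hw => ?_
  obtain ⟨f, hf, hwf⟩ := mem_cosets.1 (hWF hw)
  refine Set.mem_biUnion hf (Or.inr ⟨hWA hw, fun hwA => hu _ hwf ?_⟩)
  rw [mem_rightTranslate] at hwA
  simpa [mul_assoc] using hwA

theorem SmallInter.symm (h : SmallInter A B) : SmallInter B A := by
  obtain ⟨H, K, hA, hB, hAB⟩ := h
  obtain ⟨u, hu⟩ := exists_coset_disjoint hA.1.1 hA.not_hFinite hAB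
  refine ⟨K, H, hB, hA, ?_⟩
  rw [Set.inter_comm]
  exact hB.1.hFinite_of_coset_disjoint Set.inter_subset_right hAB hu

/-- `A` is contained in `B` up to a small set. This is a preorder on nontrivial almost invariant
sets, whose associated equivalence relation is `Equivalent`. -/
def AlmostSubset (A B : Set G) : Prop := SmallInter A Bᶜ

theorem almostSubset_of_subset (hA : IsNontrivial A) (hB : IsNontrivial B) (h : A ⊆ B) :
    AlmostSubset A B := by
  refine (smallInter_iff hA hB.compl).2 ⟨∅, Set.finite_empty, ?_⟩
  rw [Set.mul_empty]
  exact (Set.sdiff_eq_empty.2 h).subset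

theorem AlmostSubset.trans (h : AlmostSubset A B) (h' : AlmostSubset B C) :
    AlmostSubset A C := by
  have hA := h.isNontrivial_left
  have hB := h'.isNontrivial_left
  have hC := h'.isNontrivial_right
  have hBc := hB.compl.isNontrivialAI_stabilizer
  have hBcA : HFinite (stabilizer G Bᶜ) (Bᶜ ∩ A) :=
    (smallInter_iff hB.compl hA).1 (SmallInter.symm h)
  have hBC : HFinite (stabilizer G Bᶜ) (B ∩ Cᶜ) := by
    rw [stabilizer_compl]
    exact (smallInter_iff hB hC).1 h'
  obtain ⟨u, hu⟩ := exists_coset_disjoint hBc.1.1 hBc.not_hFinite hBcA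
  refine (smallInter_iff hA hC).2 (hA.isNontrivialAI_stabilizer.1.hFinite_of_coset_disjoint
    Set.inter_subset_left ((hBcA.union hBC).mono fun x hx => ?_) hu)
  by_cases hxB : x ∈ B
  · exact Or.inr ⟨hxB, hx.2⟩
  · exact Or.inl ⟨hxB, hx.1⟩

theorem equivalent_iff_almostSubset (hA : IsNontrivial A) (hB : IsNontrivial B) :
    Equivalent A B ↔ AlmostSubset A B ∧ AlmostSubset B A := by
  have hBA : AlmostSubset B A ↔ SmallInter Aᶜ B := ⟨SmallInter.symm, SmallInter.symm⟩
  rw [equivalent_iff_almostEq hA hB, hBA, AlmostSubset, smallInter_iff hA hB.compl,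
    smallInter_iff hA.compl hB, stabilizer_compl]
  refine ⟨fun h => ⟨h.mono fun x hx => Or.inl hx, h.mono fun x hx => Or.inr hx.symm⟩,
    fun h => (h.1.union h.2).mono fun x hx => hx.imp id And.symm⟩

theorem AlmostSubset.congr (h : AlmostSubset A B) (hA : Equivalent A A') (hB : Equivalent B B') :
    AlmostSubset A' B' := by
  have nA := h.isNontrivial_left
  have nB := isNontrivial_compl_iff.1 h.isNontrivial_right
  exact (((equivalent_iff_almostSubset nA (nA.of_equivalent hA)).1 hA).2.trans h).trans
    ((equivalent_iff_almostSubset nB (nB.of_equivalent hB)).1 hB).1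

theorem almostLE_iff (hA : IsNontrivial A) (hB : IsNontrivial B) :
    AlmostLE A B ↔ AlmostSubset A B ∧ (Equivalent A B → A ⊆ B) := by
  have hE := equivalent_iff_almostSubset hA hB
  constructor
  · rintro (hAB | ⟨hAB, -, hBA, -⟩)
    · have hsub : A ⊆ B := Set.sdiff_eq_empty.1 hAB
      exact ⟨almostSubset_of_subset hA hB hsub, fun _ => hsub⟩
    · exact ⟨hAB, fun h => absurd (SmallInter.symm (hE.1 h).2) hBA⟩
  · rintro ⟨hAB, hsub⟩
    by_cases h : Equivalent A B
    · exact Or.inl (Set.sdiff_eq_empty.2 (hsub h))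
    · exact Or.inr ⟨hAB, fun hAB' => hAB'.not_compl hAB,
        fun hBA => h (hE.2 ⟨hAB, hBA.symm⟩),
        fun hAB' => (SmallInter.symm hAB).not_compl hAB'.symm⟩

theorem isPartialOrder_almostLE {Y : Set G} (hY : IsNontrivial Y) :
    IsPartialOrder (E Y) (fun A B => AlmostLE (A : Set G) B) where
  refl A := Or.inl (Set.inter_compl_self _)
  antisymm A B hAB hBA := by
    have nA := hY.of_mem_E A.2
    have nB := hY.of_mem_E B.2
    rw [almostLE_iff nA nB] at hAB
    rw [almostLE_iff nB nA] at hBA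
    have e := (equivalent_iff_almostSubset nA nB).2 ⟨hAB.1, hBA.1⟩
    exact Subtype.ext ((hAB.2 e).antisymm (hBA.2 (e.symm nA)))
  trans A B C hAB hBC := by
    have nA := hY.of_mem_E A.2
    have nB := hY.of_mem_E B.2
    have nC := hY.of_mem_E C.2
    rw [almostLE_iff nA nB] at hAB
    rw [almostLE_iff nB nC] at hBC
    refine (almostLE_iff nA nC).2 ⟨hAB.1.trans hBC.1, fun e => ?_⟩
    have hCA := ((equivalent_iff_almostSubset nA nC).1 e).2
    have eAB := (equivalent_iff_almostSubset nA nB).2 ⟨hAB.1, hBC.1.trans hCA⟩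
    have eBC := (equivalent_iff_almostSubset nB nC).2 ⟨hBC.1, hCA.trans hAB.1⟩
    exact (hAB.2 eAB).trans (hBC.2 eBC)

end AlmostSubset

/-! ### Good position -/

section GoodPosition

variable {K L : Subgroup G} {A B Y Z : Set G}

theorem self_mem_E (Y : Set G) : Y ∈ E Y := ⟨1, Or.inl (one_smul _ _).symm⟩

theorem GoodPosition.subset_or_subset (gY : GoodPosition Y) (hY : IsNontrivial Y) (hA : A ∈ E Y)
    (hB : B ∈ E Y) (h : Equivalent A B) : A ⊆ B ∨ B ⊆ A := by
  have nA := hY.of_mem_E hA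
  have nB := hY.of_mem_E hB
  obtain ⟨hAB, hBA⟩ := (equivalent_iff_almostSubset nA nB).1 h
  have hempty := gY A hA B hB
    ⟨(true, false), (false, true), by decide, hAB, SmallInter.symm hBA⟩
  have hsmall : ∀ {C D : Set G}, IsNontrivial C → IsNontrivial D → C ∩ D = ∅ → SmallInter C D :=
    fun nC nD hCD => by
      simpa [AlmostSubset] using almostSubset_of_subset nC nD.compl
        (Set.disjoint_iff_inter_eq_empty.2 hCD).subset_compl_right
  obtain ⟨⟨i, j⟩, hij⟩ := hempty
  cases i <;> cases j <;> simp only [side, if_true, Bool.false_eq_true, if_false] at hij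
  · exact ((SmallInter.symm hBA).not_compl (hsmall nA.compl nB.compl hij)).elim
  · rw [Set.inter_comm] at hij
    exact Or.inr (Set.sdiff_eq_empty.1 hij)
  · exact Or.inl (Set.sdiff_eq_empty.1 hij)
  · exact ((hsmall nA nB hij).not_compl hAB).elim

theorem exists_pow_mem_of_hFinite (h : HFinite K (L : Set G)) {g : G} (hg : g ∈ L) :
    ∃ m : ℕ, m ≠ 0 ∧ g ^ m ∈ K := by
  have hmem : ∀ n : ℕ, Quotient.mk (QuotientGroup.rightRel K) (g ^ n) ∈ cosetImage K (L : Set G) :=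
    fun n => ⟨g ^ n, L.pow_mem hg n, rfl⟩
  obtain ⟨i, j, hij, heq⟩ := Set.Finite.exists_lt_map_eq_of_forall_mem hmem (hFinite_iff.1 h)
  refine ⟨j - i, by omega, ?_⟩
  rw [pow_sub g hij.le]
  exact QuotientGroup.rightRel_apply.1 (Quotient.exact heq)

theorem smul_eq_of_pow_smul_eq {g : G} {m : ℕ} (hm : m ≠ 0) (h : g ^ m • A = A)
    (hg : g • A ⊆ A ∨ A ⊆ g • A) : g • A = A := by
  have hmono : Monotone fun B : Set G => g • B := fun _ _ => Set.smul_set_mono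
  have hiter : ∀ n : ℕ, (fun B : Set G => g • B)^[n] A = g ^ n • A :=
    fun n => smul_iterate_apply g n A
  have h1 : 1 ≤ m := Nat.one_le_iff_ne_zero.2 hm
  rcases hg with hg | hg
  · have := hmono.antitone_iterate_of_map_le hg h1
    simp only [hiter, h, pow_one] at this
    exact hg.antisymm this
  · have := hmono.monotone_iterate_of_le_map hg h1
    simp only [hiter, h, pow_one] at this
    exact Set.Subset.antisymm this hg

theorem GoodPosition.smul_eq_of_hFinite (gY : GoodPosition Y) (hY : IsNontrivial Y)
    (hL : HFinite (stabilizer G Y) (L : Set G)) {g : G} {n : ℕ} (hn : n ≠ 0) (hgL : g ^ n ∈ L)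
    (hg : Equivalent (g • Y) Y) : g • Y = Y := by
  obtain ⟨m, hm, hgm⟩ := exists_pow_mem_of_hFinite hL hgL
  rw [← pow_mul] at hgm
  exact smul_eq_of_pow_smul_eq (Nat.mul_ne_zero hn hm) hgm
    (gY.subset_or_subset hY (smul_mem_E g (self_mem_E Y)) (self_mem_E Y) hg)

theorem GoodPosition.stabilizer_le (gZ : GoodPosition Z) (hA : IsNontrivial A)
    (e : Equivalent A Z) : stabilizer G A ≤ stabilizer G Z := by
  intro g hg
  have hZ := hA.of_equivalent e
  have hgA : Equivalent (g • A) A := by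
    rw [MulAction.mem_stabilizer_iff.1 hg]
    exact hA.equivalent_refl
  have hfin := (comm_aux hA.isNontrivialAI_stabilizer hZ.isNontrivialAI_stabilizer.1
    (e.almostEq_stabilizer hA)).1
  exact gZ.smul_eq_of_hFinite hZ hfin one_ne_zero (by rwa [pow_one]) (e.smul_self_congr hA hgA)

theorem GoodPosition.stabilizer_eq (gY : GoodPosition Y) (gZ : GoodPosition Z)
    (hY : IsNontrivial Y) (e : Equivalent Y Z) : stabilizer G Y = stabilizer G Z :=
  (gZ.stabilizer_le hY e).antisymm (gY.stabilizer_le (hY.of_equivalent e) (e.symm hY))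

theorem E_smul (k : G) (Y : Set G) : E (k • Y) = E Y := by
  ext A
  constructor
  · rintro ⟨g, rfl | rfl⟩
    · exact ⟨g * k, Or.inl (mul_smul _ _ _).symm⟩
    · exact ⟨g * k, Or.inr (by rw [← Set.smul_set_compl, mul_smul])⟩
  · rintro ⟨g, rfl | rfl⟩
    · exact ⟨g * k⁻¹, Or.inl (by rw [mul_smul, inv_smul_smul])⟩
    · exact ⟨g * k⁻¹, Or.inr (by rw [← Set.smul_set_compl, mul_smul, inv_smul_smul])⟩

theorem GoodPosition.smul (gY : GoodPosition Y) (k : G) : GoodPosition (k • Y) := by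
  rwa [GoodPosition, E_smul]

end GoodPosition

/-! ### Heights -/

section RelCard

variable {α β : Type*} {a b c : Set α}

/-- The signed number of elements by which `b` exceeds `a`. It is only meaningful when the symmetric
difference of `a` and `b` is finite, as `Set.ncard` is `0` on infinite sets. -/
noncomputable def relCard (a b : Set α) : ℤ := (b \ a).ncard - (a \ b).ncard

theorem relCard_swap (a b : Set α) : relCard b a = -relCard a b :=
  (neg_sub _ _).symm

theorem relCard_compl (a b : Set α) : relCard aᶜ bᶜ = -relCard a b := by
  rw [relCard, relCard, compl_sdiff_compl, compl_sdiff_compl, neg_sub]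

theorem relCard_image {f : α → β} (hf : f.Injective) (a b : Set α) :
    relCard (f '' a) (f '' b) = relCard a b := by
  simp only [relCard, ← Set.image_sdiff hf, Set.ncard_image_of_injective _ hf]

theorem relCard_eq_ncard_inter_sub_ncard_inter {F : Set α} (hF : F.Finite) (h : a ∆ b ⊆ F) :
    relCard a b = (b ∩ F).ncard - (a ∩ F).ncard := by
  have hab : (a ∩ F) \ b = a \ b := by
    rw [Set.inter_sdiff_right_comm, Set.inter_eq_left.2 fun x hx => h (Or.inl hx)]
  have hba : (b ∩ F) \ a = b \ a := by
    rw [Set.inter_sdiff_right_comm, Set.inter_eq_left.2 fun x hx => h (Or.inr hx)]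
  rw [← Set.ncard_inter_add_ncard_sdiff_eq_ncard (b ∩ F) a (hF.inter_of_right b),
    ← Set.ncard_inter_add_ncard_sdiff_eq_ncard (a ∩ F) b (hF.inter_of_right a),
    hab, hba, show b ∩ F ∩ a = a ∩ F ∩ b by grind, relCard]
  push_cast
  ring

theorem relCard_add (hab : (a ∆ b).Finite) (hbc : (b ∆ c).Finite) :
    relCard a b + relCard b c = relCard a c := by
  have hF := hab.union hbc
  rw [relCard_eq_ncard_inter_sub_ncard_inter hF Set.subset_union_left,
    relCard_eq_ncard_inter_sub_ncard_inter hF Set.subset_union_right,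
    relCard_eq_ncard_inter_sub_ncard_inter hF (symmDiff_triangle a b c)]
  ring

theorem subset_iff_relCard_nonneg (hab : (a ∆ b).Finite) (h : a ⊆ b ∨ b ⊆ a) :
    a ⊆ b ↔ 0 ≤ relCard a b := by
  constructor
  · intro hsub
    simp [relCard, Set.sdiff_eq_empty.2 hsub]
  · intro hnonneg
    rcases h with hsub | hsub
    · exact hsub
    · have hcard : (a \ b).ncard = 0 := by
        simpa [relCard, Set.sdiff_eq_empty.2 hsub] using hnonneg
      exact Set.sdiff_eq_empty.1 ((Set.ncard_eq_zero (hab.subset fun _ => Or.inl)).1 hcard)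

end RelCard

section CosetImage

variable {S : Subgroup G} {A B : Set G}

theorem cosetImage_compl (hA : ∀ s ∈ S, s • A = A) : cosetImage S Aᶜ = (cosetImage S A)ᶜ := by
  have hAc : ∀ s ∈ S, s • Aᶜ = Aᶜ := fun s hs => by rw [Set.smul_set_compl, hA s hs]
  ext q
  induction q using Quotient.inductionOn with | _ x => ?_
  rw [Set.mem_compl_iff, mk_mem_cosetImage hAc, mk_mem_cosetImage hA, Set.mem_compl_iff]

theorem cosetImage_symmDiff (hA : ∀ s ∈ S, s • A = A) (hB : ∀ s ∈ S, s • B = B) :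
    cosetImage S (A ∆ B) = cosetImage S A ∆ cosetImage S B := by
  have hAB : ∀ s ∈ S, s • (A ∆ B) = A ∆ B := fun s hs => by
    rw [Set.smul_set_symmDiff, hA s hs, hB s hs]
  ext q
  induction q using Quotient.inductionOn with | _ x => ?_
  simp only [Set.mem_symmDiff, mk_mem_cosetImage hAB, mk_mem_cosetImage hA, mk_mem_cosetImage hB]

theorem cosetImage_subset_cosetImage_iff (hB : ∀ s ∈ S, s • B = B) :
    cosetImage S A ⊆ cosetImage S B ↔ A ⊆ B :=
  ⟨fun h x hx => (mk_mem_cosetImage hB).1 (h ⟨x, hx, rfl⟩), Set.image_mono⟩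

theorem exists_injective_image_cosetImage (S : Subgroup G) (g : G) :
    ∃ f : Quotient (QuotientGroup.rightRel S) →
        Quotient (QuotientGroup.rightRel (conjSubgroup g S)),
      f.Injective ∧ ∀ W : Set G, cosetImage (conjSubgroup g S) (g • W) = f '' cosetImage S W := by
  have hrel : ∀ x y : G, QuotientGroup.rightRel (conjSubgroup g S) (g * x) (g * y) ↔
      QuotientGroup.rightRel S x y := fun x y => by
    simp only [QuotientGroup.rightRel_apply, mem_conjSubgroup]
    simp [mul_assoc]
  refine ⟨Quotient.map (g * ·) fun x y h => (hrel x y).2 h, fun p q => ?_, fun W => ?_⟩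
  · induction p, q using Quotient.inductionOn₂ with | _ x y => ?_
    exact fun h => Quotient.sound ((hrel x y).1 (Quotient.exact h))
  · rw [cosetImage, cosetImage, Set.image_image, ← Set.image_smul, Set.image_image]
    rfl

end CosetImage

section Height

variable {A B C Y Z : Set G}

/-- `A` and `B` have the same stabilizer and differ by finitely many of its cosets: the relation on
subsets of `G` on which `height` is additive. It holds between equivalent sets in good position, by
`GoodPosition.commensurate`. -/
structure Commensurate (A B : Set G) : Prop where
  stabilizer_eq : stabilizer G A = stabilizer G B
  almostEq : AlmostEq (stabilizer G A) A B

theorem Commensurate.refl (A : Set G) : Commensurate A A := ⟨rfl, AlmostEq.refl _ _⟩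

theorem Commensurate.equivalent (h : Commensurate A B) (hA : IsNontrivial A)
    (hB : IsNontrivial B) : Equivalent A B :=
  (equivalent_iff_almostEq hA hB).2 h.almostEq

theorem Commensurate.symm (h : Commensurate A B) : Commensurate B A :=
  ⟨h.stabilizer_eq.symm, h.stabilizer_eq ▸ h.almostEq.symm⟩

theorem Commensurate.trans (h : Commensurate A B) (h' : Commensurate B C) : Commensurate A C :=
  ⟨h.stabilizer_eq.trans h'.stabilizer_eq, h.almostEq.trans (h.stabilizer_eq ▸ h'.almostEq)⟩

theorem stabilizer_smul_eq_conjSubgroup (g : G) (A : Set G) :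
    stabilizer G (g • A) = conjSubgroup g (stabilizer G A) :=
  MulAction.stabilizer_smul_eq_stabilizer_map_conj g A

theorem Commensurate.smul (h : Commensurate A B) (g : G) : Commensurate (g • A) (g • B) where
  stabilizer_eq := by simp only [stabilizer_smul_eq_conjSubgroup, h.stabilizer_eq]
  almostEq := by
    rw [stabilizer_smul_eq_conjSubgroup, AlmostEq, hFinite_conj, ← Set.smul_set_symmDiff,
      inv_smul_smul]
    exact h.almostEq

theorem Commensurate.compl (h : Commensurate A B) : Commensurate Aᶜ Bᶜ where
  stabilizer_eq := by simp only [stabilizer_compl, h.stabilizer_eq]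
  almostEq := by
    rw [stabilizer_compl]
    exact h.almostEq.compl

theorem GoodPosition.commensurate (gA : GoodPosition A) (gB : GoodPosition B)
    (hA : IsNontrivial A) (e : Equivalent A B) : Commensurate A B :=
  ⟨gA.stabilizer_eq gB hA e, e.almostEq_stabilizer hA⟩

theorem Commensurate.smul_right_eq (h : Commensurate A B) :
    ∀ s ∈ stabilizer G A, s • B = B := fun _ hs => by
  rw [h.stabilizer_eq] at hs
  exact hs

theorem Commensurate.finite_symmDiff (h : Commensurate A B) :
    (cosetImage (stabilizer G A) A ∆ cosetImage (stabilizer G A) B).Finite := by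
  rw [← cosetImage_symmDiff (fun _ hs => hs) h.smul_right_eq]
  exact hFinite_iff.1 h.almostEq

/-- The signed number of cosets of the stabilizer of `A` by which `B` exceeds `A`. It is meant for
sets with `Commensurate A B`. -/
noncomputable def height (A B : Set G) : ℤ :=
  relCard (cosetImage (stabilizer G A) A) (cosetImage (stabilizer G A) B)

theorem height_self (A : Set G) : height A A = 0 := sub_self _

theorem Commensurate.height_add (h : Commensurate A B) (h' : Commensurate B C) :
    height A B + height B C = height A C := by
  have hBC := h'.finite_symmDiff
  rw [← h.stabilizer_eq] at hBC
  rw [height, height, height, ← h.stabilizer_eq]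
  exact relCard_add h.finite_symmDiff hBC

theorem Commensurate.height_swap (h : Commensurate A B) : height B A = -height A B := by
  rw [height, height, ← h.stabilizer_eq, relCard_swap]

theorem height_smul (g : G) (A B : Set G) : height (g • A) (g • B) = height A B := by
  obtain ⟨f, hf, himage⟩ := exists_injective_image_cosetImage (stabilizer G A) g
  rw [height, height, stabilizer_smul_eq_conjSubgroup, himage, himage, relCard_image hf]

theorem Commensurate.height_compl (h : Commensurate A B) : height Aᶜ Bᶜ = -height A B := by
  rw [height, height, stabilizer_compl, cosetImage_compl fun _ hs => hs,
    cosetImage_compl h.smul_right_eq, relCard_compl]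

theorem Commensurate.subset_iff_height_nonneg (h : Commensurate A B) (hAB : A ⊆ B ∨ B ⊆ A) :
    A ⊆ B ↔ 0 ≤ height A B := by
  have hBA : cosetImage (stabilizer G A) B ⊆ cosetImage (stabilizer G A) A ↔ B ⊆ A :=
    cosetImage_subset_cosetImage_iff fun _ hs => hs
  rw [← hBA, ← cosetImage_subset_cosetImage_iff h.smul_right_eq] at hAB
  rw [← cosetImage_subset_cosetImage_iff h.smul_right_eq]
  exact subset_iff_relCard_nonneg h.finite_symmDiff hAB

theorem Commensurate.eq_of_height_eq_zero (h : Commensurate A B) (hAB : A ⊆ B ∨ B ⊆ A)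
    (h0 : height A B = 0) : A = B := by
  refine Set.Subset.antisymm ((h.subset_iff_height_nonneg hAB).2 h0.ge) ?_
  refine (h.symm.subset_iff_height_nonneg hAB.symm).2 ?_
  rw [h.height_swap, h0, neg_zero]

theorem Commensurate.smul_congr (h : Commensurate Y Z) {k : G} (hk : Commensurate Y (k • Y)) :
    Commensurate Z (k • Z) :=
  (h.symm.trans hk).trans (h.smul k)

theorem Commensurate.height_smul_congr (h : Commensurate Y Z) {k : G}
    (hk : Commensurate Y (k • Y)) : height Z (k • Z) = height Y (k • Y) := by
  rw [← (h.symm.trans hk).height_add (h.smul k), ← h.symm.height_add hk, height_smul,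
    h.height_swap]
  ring

/-- The subgroup of `ℤ` formed by the heights relative to `Y` of the translates of `Y` that are
commensurate with `Y`. -/
noncomputable def translationHeights (Y : Set G) : AddSubgroup ℤ where
  carrier := {n | ∃ k : G, Commensurate Y (k • Y) ∧ height Y (k • Y) = n}
  zero_mem' := by
    refine ⟨1, ?_⟩
    rw [one_smul]
    exact ⟨Commensurate.refl Y, height_self Y⟩
  add_mem' := by
    rintro _ _ ⟨k, hk, rfl⟩ ⟨l, hl, rfl⟩
    refine ⟨k * l, ?_⟩
    rw [mul_smul, ← hk.height_add (hl.smul k), height_smul]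
    exact ⟨hk.trans (hl.smul k), rfl⟩
  neg_mem' := by
    rintro _ ⟨k, hk, rfl⟩
    refine ⟨k⁻¹, ?_⟩
    have hk' := (hk.smul k⁻¹).symm
    rw [inv_smul_smul] at hk'
    rw [← height_smul k, smul_inv_smul, hk.height_swap]
    exact ⟨hk', rfl⟩

theorem Commensurate.translationHeights_eq (h : Commensurate Y Z) :
    translationHeights Y = translationHeights Z := by
  have hle : ∀ {A B : Set G}, Commensurate A B → translationHeights A ≤ translationHeights B := by
    rintro A B hAB _ ⟨k, hk, rfl⟩
    exact ⟨k, hAB.smul_congr hk, hAB.height_smul_congr hk⟩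
  exact (hle h).antisymm (hle h.symm)

theorem Commensurate.two_mul_height_mem (h : Commensurate Y Z) {r t : G} (hr : r • Y = Yᶜ)
    (ht : t • Z = Zᶜ) : 2 * height Y Z ∈ translationHeights Z := by
  have hrt : (r * t) • Z = (r • Z)ᶜ := by rw [mul_smul, ht, Set.smul_set_compl]
  have hY : (r • Y)ᶜ = Y := by rw [hr, compl_compl]
  have hYrt : Commensurate Y ((r * t) • Z) := by
    have := (h.smul r).compl
    rwa [hY, ← hrt] at this
  have hreflect : height Y ((r * t) • Z) = -height Y Z := by
    have := (h.smul r).height_compl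
    rwa [hY, ← hrt, height_smul] at this
  refine neg_mem_iff.1 ⟨r * t, h.symm.trans hYrt, ?_⟩
  rw [← h.symm.height_add hYrt, hreflect, h.height_swap]
  ring

end Height

/-! ### Isomorphisms -/

section TransitiveAction

theorem bijective_ofQuotientStabilizer {α : Type*} [MulAction G α] [MulAction.IsPretransitive G α]
    (a : α) : Function.Bijective (MulAction.ofQuotientStabilizer G a) :=
  ⟨MulAction.injective_ofQuotientStabilizer G a, fun x =>
    let ⟨g, hg⟩ := MulAction.exists_smul_eq G a x
    ⟨g, hg⟩⟩

theorem exists_equiv_smul_of_stabilizer_eq {α β : Type*} [MulAction G α] [MulAction G β]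
    [MulAction.IsPretransitive G α] [MulAction.IsPretransitive G β] {a : α} {b : β}
    (h : stabilizer G a = stabilizer G b) : ∃ φ : α ≃ β, ∀ g : G, φ (g • a) = g • b := by
  let φa := Equiv.ofBijective _ (bijective_ofQuotientStabilizer (G := G) a)
  let φb := Equiv.ofBijective _ (bijective_ofQuotientStabilizer (G := G) b)
  refine ⟨(φa.symm.trans (Subgroup.quotientEquivOfEq h)).trans φb, fun g => ?_⟩
  have hφa : φa.symm (g • a) = (g : G ⧸ stabilizer G a) := φa.symm_apply_eq.2 rfl
  simp only [Equiv.trans_apply, hφa, Subgroup.quotientEquivOfEq_mk]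
  rfl

end TransitiveAction

section SamePoset

variable {H : Subgroup G} {X Y Z V : Set G}

theorem isPretransitive_E {t : G} (ht : t • Y = Yᶜ) : MulAction.IsPretransitive G (E Y) := by
  refine (MulAction.isPretransitive_iff_base (⟨Y, self_mem_E Y⟩ : E Y)).2 ?_
  rintro ⟨_, g, rfl | rfl⟩
  · exact ⟨g, rfl⟩
  · exact ⟨g * t, Subtype.ext ((mul_smul g t Y).trans (congrArg (g • ·) ht))⟩

theorem stabilizer_mk_self (Y : Set G) :
    stabilizer G (⟨Y, self_mem_E Y⟩ : E Y) = stabilizer G Y := by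
  ext g
  exact Subtype.ext_iff

theorem GoodPosition.smul_subset_iff (gY : GoodPosition Y) (gZ : GoodPosition Z)
    (hY : IsNontrivial Y) (e : Equivalent Y Z) {g : G} (hg : Equivalent (g • Y) Y) :
    g • Y ⊆ Y ↔ g • Z ⊆ Z := by
  have hZ := hY.of_equivalent e
  have hgZ := e.smul_self_congr hY hg
  have cY := (gY.smul g).commensurate gY (hY.smul g) hg
  have cZ := (gZ.smul g).commensurate gZ (hZ.smul g) hgZ
  rw [cY.subset_iff_height_nonneg
      (gY.subset_or_subset hY (smul_mem_E g (self_mem_E Y)) (self_mem_E Y) hg),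
    cZ.subset_iff_height_nonneg
      (gZ.subset_or_subset hZ (smul_mem_E g (self_mem_E Z)) (self_mem_E Z) hgZ),
    cY.symm.height_swap, cZ.symm.height_swap,
    (gY.commensurate gZ hY e).height_smul_congr cY.symm]

theorem almostLE_smul_smul_iff (gY : GoodPosition Y) (gZ : GoodPosition Z) (hY : IsNontrivial Y)
    (e : Equivalent Y Z) (g k : G) :
    AlmostLE (g • Y) (k • Y) ↔ AlmostLE (g • Z) (k • Z) := by
  have hZ := hY.of_equivalent e
  have e' := e.symm hY
  have hle : AlmostSubset (g • Y) (k • Y) ↔ AlmostSubset (g • Z) (k • Z) :=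
    ⟨fun h => h.congr (e.smul g) (e.smul k), fun h => h.congr (e'.smul g) (e'.smul k)⟩
  have heq : Equivalent (g • Y) (k • Y) ↔ Equivalent (g • Z) (k • Z) :=
    ⟨e.smul_congr hY, e'.smul_congr hZ⟩
  rw [almostLE_iff (hY.smul g) (hY.smul k), almostLE_iff (hZ.smul g) (hZ.smul k), hle, ← heq]
  refine and_congr_right fun _ => imp_congr_right fun hgk => ?_
  rw [Set.subset_smul_set_iff, Set.subset_smul_set_iff, ← mul_smul, ← mul_smul]
  exact gY.smul_subset_iff gZ hY e (equivalent_smul_smul_iff.1 hgk)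

theorem samePoset_of_smul_eq_compl (gY : GoodPosition Y) (gZ : GoodPosition Z)
    (hY : IsNontrivial Y) (e : Equivalent Y Z) {t : G} (hYt : t • Y = Yᶜ) (hZt : t • Z = Zᶜ) :
    SamePoset Y Z := by
  have tY := isPretransitive_E hYt
  have tZ := isPretransitive_E hZt
  let y : E Y := ⟨Y, self_mem_E Y⟩
  let z : E Z := ⟨Z, self_mem_E Z⟩
  have hstab : stabilizer G y = stabilizer G z := by
    rw [stabilizer_mk_self, stabilizer_mk_self, gY.stabilizer_eq gZ hY e]
  obtain ⟨φ, hφ⟩ := exists_equiv_smul_of_stabilizer_eq hstab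
  have hsurj : ∀ A : E Y, ∃ g : G, g • y = A := MulAction.exists_smul_eq G y
  have hstarY : ∀ g : G, starE (g • y) = (g * t) • y := fun g => Subtype.ext <| by
    change (g • Y)ᶜ = (g * t) • Y
    rw [mul_smul, hYt, Set.smul_set_compl]
  have hstarZ : ∀ g : G, starE (g • z) = (g * t) • z := fun g => Subtype.ext <| by
    change (g • Z)ᶜ = (g * t) • Z
    rw [mul_smul, hZt, Set.smul_set_compl]
  refine ⟨φ, fun g A => ?_, fun A => ?_, fun A B => ?_, fun A => ?_⟩
  all_goals obtain ⟨a, rfl⟩ := hsurj A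
  · rw [← mul_smul, hφ, hφ, mul_smul]
  · rw [hstarY, hφ, hφ, hstarZ]
  · obtain ⟨b, rfl⟩ := hsurj B
    rw [hφ, hφ]
    exact almostLE_smul_smul_iff gY gZ hY e a b
  · rw [hφ]
    exact e.smul a

theorem SamePoset.of_smul_left {k : G} (h : SamePoset (k • Y) Z) : SamePoset Y Z := by
  obtain ⟨φ, hsmul, hstar, hle, heq⟩ := h
  let ψ : E Y ≃ E (k • Y) := Equiv.setCongr (E_smul k Y).symm
  exact ⟨ψ.trans φ, fun g A => hsmul g (ψ A), fun A => hstar (ψ A),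
    fun A B => hle (ψ A) (ψ B), fun A => heq (ψ A)⟩

/-- The set `(t Y)*` belongs to `E(Y)` and has the same height as `Y`. -/
theorem GoodPosition.smul_eq_compl_of_height_eq_zero (gY : GoodPosition Y) (hY : IsNontrivial Y)
    (c : Commensurate Y Z) (h0 : height Y Z = 0) {t : G} (ht : t • Z = Zᶜ) : t • Y = Yᶜ := by
  have hZ : (t • Z)ᶜ = Z := by rw [ht, compl_compl]
  have cZ : Commensurate Z (t • Y)ᶜ := by
    have := (c.symm.smul t).compl
    rwa [hZ] at this
  have hheight : height Z (t • Y)ᶜ = 0 := by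
    have := (c.symm.smul t).height_compl
    rwa [hZ, height_smul, c.height_swap, neg_neg, h0] at this
  have cY := c.trans cZ
  have hnested := gY.subset_or_subset hY (self_mem_E Y)
    (compl_mem_E (smul_mem_E t (self_mem_E Y))) (cY.equivalent hY (hY.smul t).compl)
  rw [eq_compl_comm]
  refine cY.eq_of_height_eq_zero hnested ?_
  rw [← c.height_add cZ, h0, hheight, add_zero]

theorem samePoset_of_height_eq_zero (gY : GoodPosition Y) (gZ : GoodPosition Z)
    (hY : IsNontrivial Y) (e : Equivalent Y Z) (iZ : IsInvertible Z) (h0 : height Y Z = 0) :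
    SamePoset Y Z :=
  let ⟨_, ht⟩ := iZ
  samePoset_of_smul_eq_compl gY gZ hY e
    (gY.smul_eq_compl_of_height_eq_zero hY (gY.commensurate gZ hY e) h0 ht) ht

theorem samePoset_of_height_mem (gY : GoodPosition Y) (gZ : GoodPosition Z)
    (hY : IsNontrivial Y) (e : Equivalent Y Z) (iZ : IsInvertible Z)
    (hm : height Y Z ∈ translationHeights Y) : SamePoset Y Z := by
  obtain ⟨k, hk, hheight⟩ := hm
  have c := gY.commensurate gZ hY e
  have hkZ := (hk.symm.trans c).equivalent (hY.smul k) (hY.of_equivalent e)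
  refine (samePoset_of_height_eq_zero (gY.smul k) gZ (hY.smul k) hkZ iZ ?_).of_smul_left
  rw [← hk.symm.height_add c, hk.height_swap, hheight, neg_add_cancel]

theorem mem_or_mem_or_sub_mem_of_two_mul_mem {M : AddSubgroup ℤ} {a b : ℤ} (ha : 2 * a ∈ M)
    (hb : 2 * b ∈ M) : a ∈ M ∨ b ∈ M ∨ b - a ∈ M := by
  obtain ⟨m, rfl⟩ := Int.subgroup_cyclic M
  simp only [← AddSubgroup.zmultiples_eq_closure, Int.mem_zmultiples_iff] at *
  obtain ⟨i, hi⟩ := ha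
  obtain ⟨j, hj⟩ := hb
  rcases Int.even_or_odd' i with ⟨p, rfl | rfl⟩
  · exact Or.inl ⟨p, by linarith⟩
  rcases Int.even_or_odd' j with ⟨q, rfl | rfl⟩
  · exact Or.inr (Or.inl ⟨q, by linarith⟩)
  · exact Or.inr (Or.inr ⟨q - p, by linarith⟩)

theorem samePoset_or_samePoset_or_samePoset (hY : IsNontrivial Y) (eZ : Equivalent Y Z)
    (eV : Equivalent Y V) (gY : GoodPosition Y) (gZ : GoodPosition Z) (gV : GoodPosition V)
    (iY : IsInvertible Y) (iZ : IsInvertible Z) (iV : IsInvertible V) :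
    SamePoset Y Z ∨ SamePoset Y V ∨ SamePoset Z V := by
  have hZ := hY.of_equivalent eZ
  have eZV := (eZ.symm hY).trans eV hZ
  have cZ := gY.commensurate gZ hY eZ
  have cV := gY.commensurate gV hY eV
  have hZV : height Z V = height Y V - height Y Z := by
    rw [← cZ.height_add (cZ.symm.trans cV), add_sub_cancel_left]
  obtain ⟨r, hr⟩ := iY
  have mZ : 2 * height Y Z ∈ translationHeights Y :=
    iZ.elim fun _ ht => cZ.translationHeights_eq ▸ cZ.two_mul_height_mem hr ht
  have mV : 2 * height Y V ∈ translationHeights Y :=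
    iV.elim fun _ ht => cV.translationHeights_eq ▸ cV.two_mul_height_mem hr ht
  refine (mem_or_mem_or_sub_mem_of_two_mul_mem mZ mV).imp
    (samePoset_of_height_mem gY gZ hY eZ iZ) (Or.imp
      (samePoset_of_height_mem gY gV hY eV iV) fun hm => ?_)
  rw [← hZV, cZ.translationHeights_eq] at hm
  exact samePoset_of_height_mem gZ gV hZ eZV iV hm

theorem GoodPosition.smul_eq_of_finiteIndex (gY : GoodPosition Y) (hX : IsNontrivialAI H X)
    (e : Equivalent X Y) (hfin : (H.subgroupOf (stabK hX)).FiniteIndex) {g : G}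
    (hg : Equivalent (g • Y) Y) : g • Y = Y := by
  have nX : IsNontrivial X := ⟨H, hX⟩
  have hY := nX.of_equivalent e
  have hgK : g ∈ stabK hX := Or.inl ((e.symm nX).smul_self_congr hY hg)
  obtain ⟨n, hn, -, hgn⟩ := Subgroup.exists_pow_mem_of_index_ne_zero hfin.index_ne_zero ⟨g, hgK⟩
  have hXY : AlmostEq H X Y := (nX.hFinite_iff_stabilizer hX.1).2 (e.almostEq_stabilizer nX)
  exact gY.smul_eq_of_hFinite hY (comm_aux hX hY.isNontrivialAI_stabilizer.1 hXY).1 hn.ne'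
    (Subgroup.mem_subgroupOf.1 hgn) hg

theorem samePoset_of_finiteIndex (hX : IsNontrivialAI H X)
    (hfin : (H.subgroupOf (stabK hX)).FiniteIndex) (eY : Equivalent X Y) (eZ : Equivalent X Z)
    (gY : GoodPosition Y) (gZ : GoodPosition Z) (iY : IsInvertible Y) (iZ : IsInvertible Z) :
    SamePoset Y Z := by
  have nX : IsNontrivial X := ⟨H, hX⟩
  have hY := nX.of_equivalent eY
  have hZ := nX.of_equivalent eZ
  have e := (eY.symm nX).trans eZ hY
  refine samePoset_of_height_eq_zero gY gZ hY e iZ ?_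
  obtain ⟨r, hr⟩ := iY
  obtain ⟨t, ht⟩ := iZ
  obtain ⟨k, hk, hheight⟩ := (gY.commensurate gZ hY e).two_mul_height_mem hr ht
  rw [gZ.smul_eq_of_finiteIndex hX eZ hfin (hk.symm.equivalent (hZ.smul k) hZ),
    height_self] at hheight
  omega

end SamePoset

end AlmostInvariant

theorem mainTheorem6_general {G : Type*} [Group G] (H : Subgroup G)
    (X Y Z V : Set G) (hX : IsNontrivialAI H X)
    (hY : Equivalent X Y) (hZ : Equivalent X Z) (hV : Equivalent X V)
    (gY : GoodPosition Y) (gZ : GoodPosition Z) (gV : GoodPosition V)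
    (iY : IsInvertible Y) (iZ : IsInvertible Z)
    (iV : IsInvertible V) :
    (IsPartialOrder (E Y) (fun A B => AlmostLE (A : Set G) B) ∧
      IsPartialOrder (E Z) (fun A B => AlmostLE (A : Set G) B) ∧
      IsPartialOrder (E V) (fun A B => AlmostLE (A : Set G) B)) ∧
    ((SamePoset Y Z ∧ SamePoset Y V ∧ SamePoset Z V) ∨
      (¬ (H.subgroupOf (stabK hX)).FiniteIndex ∧
        (SamePoset Y Z ∨ SamePoset Y V ∨ SamePoset Z V))) := by
  have nX : IsNontrivial X := ⟨H, hX⟩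
  have nY := nX.of_equivalent hY
  refine ⟨⟨isPartialOrder_almostLE nY, isPartialOrder_almostLE (nX.of_equivalent hZ),
    isPartialOrder_almostLE (nX.of_equivalent hV)⟩, ?_⟩
  by_cases hfin : (H.subgroupOf (stabK hX)).FiniteIndex
  · exact Or.inl ⟨samePoset_of_finiteIndex hX hfin hY hZ gY gZ iY iZ,
      samePoset_of_finiteIndex hX hfin hY hV gY gV iY iV,
      samePoset_of_finiteIndex hX hfin hZ hV gZ gV iZ iV⟩
  · have hX' := hY.symm nX
    exact Or.inr ⟨hfin, samePoset_or_samePoset_or_samePoset nY (hX'.trans hZ nY)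
      (hX'.trans hV nY) gY gZ gV iY iZ iV⟩

theorem mainTheorem6 {G : Type*} [Group G] [Group.FG G] (H : Subgroup G) (hH : H.FG)
    (X Y Z V : Set G) (hX : IsNontrivialAI H X)
    (hY : Equivalent X Y) (hZ : Equivalent X Z) (hV : Equivalent X V)
    (gY : GoodPosition Y) (gZ : GoodPosition Z) (gV : GoodPosition V)
    (iY : IsInvertible Y) (iZ : IsInvertible Z)
    (iV : IsInvertible V) :
    (IsPartialOrder (E Y) (fun A B => AlmostLE (A : Set G) B) ∧
      IsPartialOrder (E Z) (fun A B => AlmostLE (A : Set G) B) ∧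
      IsPartialOrder (E V) (fun A B => AlmostLE (A : Set G) B)) ∧
    ((SamePoset Y Z ∧ SamePoset Y V ∧ SamePoset Z V) ∨
      (¬ (H.subgroupOf (stabK hX)).FiniteIndex ∧
        (SamePoset Y Z ∨ SamePoset Y V ∨ SamePoset Z V))) :=
  mainTheorem6_general H X Y Z V hX hY hZ hV gY gZ gV iY iZ iV
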